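/- Let $d\ge 1$ and let $Q:\mathbb R^d\to\mathbb R$ be any quadratic form, possibly indefinite or degenerate. A \emph{$Q$-ball} is a region $\{x\in\mathbb R^d : Q(x)\le \varphi(x)+D\}$ with $\varphi$ a linear functional and $D\in\mathbb R$; a \emph{$Q$-sphere} is the topological boundary of a $Q$-ball. Let $X\subset\mathbb R^d$ be a finite set with at least $d+1$ points which is in spacelike position, i.e. $Q(x-y)>0$ for all distinct $x,y\in X$, and in generic position, i.e. no $d+1$ points of $X$ lie in an affine hyperplane and no $d+2$ points of $X$ lie on a $Q$-sphere. A \emph{cell decomposition} of the convex hull $\mathrm{CH}(X)$ is a finite collection of nonempty convex polytopes (cells) with union $\mathrm{CH}(X)$ such that every nonempty face of a cell is a cell and the intersection of two cells is empty or a face of both; its \emph{$0$-skeleton} is the set of its $0$-dimensional cells. A polytope $c$ is \emph{inscribed} in a $Q$-ball $B$ if $c\subset B$ and $c\cap\partial B$ is exactly the set of vertices of $c$. A \emph{$Q$-Delaunay decomposition} for $X$ is a cell decomposition of $\mathrm{CH}(X)$ with $0$-skeleton $X$ such that every cell is inscribed in a $Q$-ball whose interior contains no point of $X$, and such that for every $d$-dimensional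 cell this $Q$-ball is unique. Then $X$ has a unique $Q$-Delaunay decomposition. Its cells are exactly the projections to $\mathbb R^d$ of the lower faces (of all dimensions) of the convex hull $\mathscr C\subset\mathbb R^d\times\mathbb R$ of $\{(x,Q(x)) : x\in X\}$, where a lower face of $\mathscr C$ is the set of points of $\mathscr C$ at which some linear functional $(x,t)\mapsto\psi(x)+at$ with $a>0$ attains its minimum over $\mathscr C$. -/

import Mathlib

/-- `ℝ^d`. -/
abbrev RSpace (d : ℕ) : Type := EuclideanSpace ℝ (Fin d)

/-- The region `{x | Q x ≤ φ x + D}`, with `φ` a linear functional and `D` a constant. -/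
def qBall {d : ℕ} (Q : QuadraticForm ℝ (RSpace d)) (φ : Module.Dual ℝ (RSpace d)) (D : ℝ) :
    Set (RSpace d) :=
  {x | Q x ≤ φ x + D}

/-- `B` is a `Q`-ball. -/
def IsQBall {d : ℕ} (Q : QuadraticForm ℝ (RSpace d)) (B : Set (RSpace d)) : Prop :=
  ∃ (φ : Module.Dual ℝ (RSpace d)) (D : ℝ), B = qBall Q φ D

/-- A `Q`-sphere is the boundary of a `Q`-ball. -/
def IsQSphere {d : ℕ} (Q : QuadraticForm ℝ (RSpace d)) (S : Set (RSpace d)) : Prop :=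
  ∃ B : Set (RSpace d), IsQBall Q B ∧ S = frontier B

/-- `X` is in spacelike position with respect to `Q`. -/
def SpacelikePosition {d : ℕ} (Q : QuadraticForm ℝ (RSpace d)) (X : Finset (RSpace d)) : Prop :=
  ∀ x ∈ X, ∀ y ∈ X, x ≠ y → 0 < Q (x - y)

/-- `H` is an affine hyperplane of `ℝ^d`. -/
def IsAffineHyperplane {d : ℕ} (H : Set (RSpace d)) : Prop :=
  ∃ (l : Module.Dual ℝ (RSpace d)) (c : ℝ), l ≠ 0 ∧ H = {x | l x = c}

/-- No `d + 1` points of `X` lie in an affine hyperplane, and no `d + 2` points of `X` lie on a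
`Q`-sphere. -/
def GenericPosition {d : ℕ} (Q : QuadraticForm ℝ (RSpace d)) (X : Finset (RSpace d)) : Prop :=
  (∀ s : Finset (RSpace d), s ⊆ X → s.card = d + 1 →
    ∀ H : Set (RSpace d), IsAffineHyperplane H → ¬ (s : Set (RSpace d)) ⊆ H) ∧
  (∀ s : Finset (RSpace d), s ⊆ X → s.card = d + 2 →
    ∀ S : Set (RSpace d), IsQSphere Q S → ¬ (s : Set (RSpace d)) ⊆ S)

/-- `K` is (the set of closed cells of) a cell decomposition of the set `P`: a finite polytopal
complex, cells of all dimensions included, with union `P`. The faces of a polytope are its exposed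
subsets; according to `IsExposed` the empty set is exposed too, but it is never a cell. -/
structure IsCellDecomposition {d : ℕ} (P : Set (RSpace d)) (K : Set (Set (RSpace d))) : Prop where
  finite : K.Finite
  polytope : ∀ c ∈ K, ∃ s : Finset (RSpace d), s.Nonempty ∧ c = convexHull ℝ (s : Set (RSpace d))
  face_mem : ∀ c ∈ K, ∀ f : Set (RSpace d), f.Nonempty → IsExposed ℝ c f → f ∈ K
  inter_face : ∀ c ∈ K, ∀ c' ∈ K, IsExposed ℝ c (c ∩ c') ∧ IsExposed ℝ c' (c ∩ c')
  sUnion_eq : ⋃₀ K = P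

/-- The set of `0`-cells of `K`. -/
def zeroSkeleton {d : ℕ} (K : Set (Set (RSpace d))) : Set (RSpace d) :=
  {x | {x} ∈ K}

/-- The polytope `c` is inscribed in `B`: it is contained in `B` and meets the boundary of `B`
exactly in its vertices. -/
def IsInscribed {d : ℕ} (c B : Set (RSpace d)) : Prop :=
  c ⊆ B ∧ c ∩ frontier B = c.extremePoints ℝ

/-- `B` is a `Q`-ball which has no point of `X` in its interior and in which `c` is inscribed. -/
def IsEmptyCircumball {d : ℕ} (Q : QuadraticForm ℝ (RSpace d)) (X : Finset (RSpace d))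
    (c B : Set (RSpace d)) : Prop :=
  IsQBall Q B ∧ IsInscribed c B ∧ ∀ x ∈ X, x ∉ interior B

/-- `K` is a `Q`-Delaunay decomposition for `X`. Every cell is inscribed in an empty `Q`-ball; that
ball is required to be unique for the `d`-dimensional cells. -/
structure IsQDelaunay {d : ℕ} (Q : QuadraticForm ℝ (RSpace d)) (X : Finset (RSpace d))
    (K : Set (Set (RSpace d))) : Prop where
  cellDecomposition : IsCellDecomposition (convexHull ℝ (X : Set (RSpace d))) K
  zeroSkeleton_eq : zeroSkeleton K = (X : Set (RSpace d))
  exists_ball : ∀ c ∈ K, ∃ B : Set (RSpace d), IsEmptyCircumball Q X c B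
  unique_ball : ∀ c ∈ K, affineSpan ℝ c = ⊤ → ∃! B : Set (RSpace d), IsEmptyCircumball Q X c B

/-- The convex hull in `ℝ^d × ℝ` of the lift of `X` to the graph of `Q`. -/
def liftedHull {d : ℕ} (Q : QuadraticForm ℝ (RSpace d)) (X : Finset (RSpace d)) :
    Set (RSpace d × ℝ) :=
  convexHull ℝ ((fun x => (x, Q x)) '' (X : Set (RSpace d)))

/-- `F` is a lower face, of any dimension, of `C ⊆ ℝ^d × ℝ`: the set of minimisers over `C` of a
linear functional `(x, t) ↦ ψ x + a * t` with `a > 0` (that is, `F` has an inward normal with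
positive last component). -/
def IsLowerFace {d : ℕ} (C F : Set (RSpace d × ℝ)) : Prop :=
  ∃ (ψ : Module.Dual ℝ (RSpace d)) (a : ℝ), 0 < a ∧
    F = {p | p ∈ C ∧ ∀ q ∈ C, ψ p.1 + a * p.2 ≤ ψ q.1 + a * q.2}

/-- The projections to `ℝ^d` of the lower faces of the convex hull of the lift of `X`. -/
def projectedLowerFaces {d : ℕ} (Q : QuadraticForm ℝ (RSpace d)) (X : Finset (RSpace d)) :
    Set (Set (RSpace d)) :=
  {c | ∃ F : Set (RSpace d × ℝ), IsLowerFace (liftedHull Q X) F ∧ c = Prod.fst '' F}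

/-! Work with affine functions `h` instead of balls. Spacelike position gives a vector with `Q > 0`,
so `{Q ≤ h}` has interior `{Q < h}` and boundary `{Q = h}`; the ball is empty exactly when `h ≤ Q`
on `X`. The candidate cells (`delaunayCells`) are the hulls of the nonempty contact sets `{x ∈ X | Q
x = h x}` of such `h`. For a convex combination of contact points, `h - Q` is half the weighted sum
of the values `Q (x - y)` (`QuadraticMap.sum_mul_mul_map_sub`). It is thus nonnegative and vanishes
only at contact points, so cells are inscribed even for indefinite `Q`. Two cells meet in a common
face because `h' - h` has opposite signs on their contact sets. A cell covers an interior point `p`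
of the hull: take `h` maximal at `p`; were `p` outside its contact hull, a separating functional
would allow an increase. For uniqueness, a cell of any decomposition has its vertices in some
contact set. Genericity makes that set affinely independent, so every nonempty subset spans a
candidate cell. Conversely, the barycentre of a candidate cell lies in a cell of the given
decomposition, which forces the former to be a face of the latter. Lower faces are the same cells,
since supporting hyperplanes from below are graphs of affine `h ≤ Q` touching at a point of `X`. -/

/-! ### Affine functions on convex hulls of finite sets -/

section FiniteHull

variable {E : Type*} [AddCommGroup E] [Module ℝ E]

/-- The part of the convex hull of a finite set on which an affine function attains an upper
bound is the convex hull of the points of the set on which it does. -/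
theorem Finset.convexHull_inter_affine_eq (s : Finset E) (l : E →ᵃ[ℝ] ℝ) (m : ℝ)
    (hl : ∀ x ∈ s, l x ≤ m) :
    {p | p ∈ convexHull ℝ (s : Set E) ∧ l p = m} = convexHull ℝ {x | x ∈ s ∧ l x = m} := by
  apply Set.Subset.antisymm
  · rintro p ⟨hp, hpm⟩
    rw [Finset.convexHull_eq] at hp
    obtain ⟨w, hw0, hw1, rfl⟩ := hp
    have hlp : l (s.centerMass w id) = ∑ x ∈ s, w x * l x := by
      rw [← affineCombination_eq_centerMass hw1, Finset.map_affineCombination _ _ _ hw1,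
        Finset.affineCombination_eq_linear_combination _ _ _ hw1]
      simp
    -- All terms are nonnegative, so weights vanish wherever `l x < m`.
    have hsum : ∑ x ∈ s, w x * (m - l x) = 0 := by
      simp only [mul_sub, Finset.sum_sub_distrib, ← Finset.sum_mul, hw1]
      rw [← hlp, hpm]; ring
    have hzero := (Finset.sum_eq_zero_iff_of_nonneg
      (fun x hx => mul_nonneg (hw0 x hx) (sub_nonneg.2 (hl x hx)))).1 hsum
    rw [← Finset.centerMass_filter_ne_zero]
    refine Finset.centerMass_mem_convexHull _ (fun x hx => hw0 x (Finset.mem_filter.1 hx).1)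
      (by rw [Finset.sum_filter_ne_zero, hw1]; norm_num) fun x hx => ?_
    obtain ⟨hx, hwx⟩ := Finset.mem_filter.1 hx
    have := (mul_eq_zero.1 (hzero x hx)).resolve_left hwx
    exact ⟨hx, by simp only [id]; linarith⟩
  · refine convexHull_min ?_ ?_
    · rintro x ⟨hx, hxm⟩
      exact ⟨subset_convexHull ℝ _ hx, hxm⟩
    · exact (convex_convexHull ℝ _).inter ((convex_singleton m).affine_preimage l)

theorem le_of_mem_convexHull_of_le (s : Set E) (l : E →ᵃ[ℝ] ℝ) (m : ℝ)
    (hl : ∀ x ∈ s, l x ≤ m) {p : E} (hp : p ∈ convexHull ℝ s) : l p ≤ m :=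
  convexHull_min (t := l ⁻¹' Set.Iic m) hl ((convex_Iic m).affine_preimage l) hp

end FiniteHull

/-! ### Vertices of polytopes -/

section ExtremePoints

variable {E : Type*} [AddCommGroup E] [Module ℝ E] [TopologicalSpace E] [IsTopologicalAddGroup E]
  [ContinuousSMul ℝ E] [LocallyConvexSpace ℝ E] [T2Space E]

/-- Krein–Milman; the closure is superfluous because there are finitely many extreme points. -/
theorem convexHull_extremePoints_convexHull (s : Finset E) :
    convexHull ℝ ((convexHull ℝ (s : Set E)).extremePoints ℝ) = convexHull ℝ (s : Set E) := by
  have h := closure_convexHull_extremePoints (s.finite_toSet.isCompact_convexHull ℝ)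
    (convex_convexHull ℝ (s : Set E))
  have hfin : ((convexHull ℝ (s : Set E)).extremePoints ℝ).Finite :=
    s.finite_toSet.subset extremePoints_convexHull_subset
  rwa [(hfin.isClosed_convexHull ℝ).closure_eq] at h

/-- Separate `v` strictly from the hull of the other points of `s`. This makes vertices of a cell
into cells. -/
theorem isExposed_singleton_of_mem_extremePoints (s : Finset E) {v : E}
    (hv : v ∈ (convexHull ℝ (s : Set E)).extremePoints ℝ) :
    IsExposed ℝ (convexHull ℝ (s : Set E)) {v} := by
  intro _
  have hvs : v ∉ convexHull ℝ ((s : Set E) \ {v}) := by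
    have h := ((convex_convexHull ℝ (s : Set E)).mem_extremePoints_iff_mem_sdiff_convexHull_sdiff.1
      hv).2
    exact fun h' => h (convexHull_mono
      (Set.sdiff_subset_sdiff_left (subset_convexHull ℝ (s : Set E))) h')
  have hfin : ((s : Set E) \ {v}).Finite := s.finite_toSet.subset Set.sdiff_subset
  obtain ⟨l, u, hlu, hu⟩ := geometric_hahn_banach_closed_point (convex_convexHull ℝ _)
    (hfin.isClosed_convexHull ℝ) hvs
  have hle : ∀ x ∈ s, (l : E →ₗ[ℝ] ℝ).toAffineMap x ≤ l v := by
    intro x hx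
    by_cases hxv : x = v
    · subst hxv; exact le_rfl
    · exact ((hlu x (subset_convexHull ℝ _ ⟨hx, hxv⟩)).trans hu).le
  refine ⟨l, ?_⟩
  have key := s.convexHull_inter_affine_eq (l : E →ₗ[ℝ] ℝ).toAffineMap (l v) hle
  have hsing : {x | x ∈ s ∧ (l : E →ₗ[ℝ] ℝ).toAffineMap x = l v} = {v} := by
    ext x
    constructor
    · rintro ⟨hx, hxl⟩
      by_contra hxv
      exact ((hlu x (subset_convexHull ℝ _ ⟨hx, hxv⟩)).trans hu).ne hxl
    · rintro rfl
      exact ⟨extremePoints_convexHull_subset hv, rfl⟩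
  rw [hsing, convexHull_singleton] at key
  rw [← key]
  ext p
  constructor
  · rintro ⟨hp, hpl⟩
    refine ⟨hp, fun y hy => ?_⟩
    have h1 := le_of_mem_convexHull_of_le _ _ _ hle hy
    have h2 : l p = l v := hpl
    rw [h2]; exact h1
  · rintro ⟨hp, hpl⟩
    exact ⟨hp, le_antisymm (le_of_mem_convexHull_of_le _ _ _ hle hp) (hpl v hv.1)⟩

end ExtremePoints

/-! ### Variance identity and strict convexity on spacelike sets -/

section QuadraticForms

variable {E : Type*} [AddCommGroup E] [Module ℝ E]

theorem QuadraticMap.map_sub_eq (Q : QuadraticForm ℝ E) (x y : E) :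
    Q (x - y) = Q x + Q y - QuadraticMap.polar Q x y := by
  have h := QuadraticMap.polar_neg_right (Q := Q) x y
  have h2 : QuadraticMap.polar Q x (-y) = Q (x + -y) - Q x - Q (-y) := rfl
  rw [QuadraticMap.map_neg] at h2
  rw [sub_eq_add_neg]
  linarith

/-- The variance identity for a quadratic form. -/
theorem QuadraticMap.sum_mul_mul_map_sub (Q : QuadraticForm ℝ E) (s : Finset E) (w : E → ℝ)
    (hw : ∑ x ∈ s, w x = 1) :
    ∑ x ∈ s, ∑ y ∈ s, w x * w y * Q (x - y)
      = 2 * (∑ x ∈ s, w x * Q x - Q (∑ x ∈ s, w x • x)) := by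
  have hpol : ∑ x ∈ s, ∑ y ∈ s, w x * w y * QuadraticMap.polar Q x y
      = 2 * Q (∑ x ∈ s, w x • x) := by
    have h : QuadraticMap.polarBilin Q (∑ x ∈ s, w x • x) (∑ x ∈ s, w x • x)
        = 2 * Q (∑ x ∈ s, w x • x) := by
      rw [QuadraticMap.polarBilin_apply_apply, QuadraticMap.polar_self]; simp
    rw [← h]
    simp only [map_sum, LinearMap.sum_apply, map_smul, LinearMap.smul_apply, smul_eq_mul,
      QuadraticMap.polarBilin_apply_apply]
    rw [Finset.sum_comm]
    refine Finset.sum_congr rfl fun x _ => ?_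
    simp only [Finset.mul_sum]
    exact Finset.sum_congr rfl fun y _ => by ring
  have h1 : ∑ x ∈ s, ∑ y ∈ s, w x * w y * Q x = ∑ x ∈ s, w x * Q x := by
    refine Finset.sum_congr rfl fun x _ => ?_
    rw [← Finset.sum_mul, ← Finset.mul_sum, hw, mul_one]
  have h2 : ∑ x ∈ s, ∑ y ∈ s, w x * w y * Q y = ∑ x ∈ s, w x * Q x := by
    rw [Finset.sum_comm, ← h1]
    exact Finset.sum_congr rfl fun x _ => Finset.sum_congr rfl fun y _ => by ring
  simp only [QuadraticMap.map_sub_eq, mul_sub, mul_add, Finset.sum_sub_distrib,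
    Finset.sum_add_distrib, hpol, h1, h2]
  ring

/-- If `h` interpolates `Q` on a spacelike set, then `Q ≤ h` on its convex hull, with equality
only on the set itself. -/
theorem QuadraticMap.le_affine_of_mem_convexHull (Q : QuadraticForm ℝ E) (s : Finset E)
    (hs : ∀ x ∈ s, ∀ y ∈ s, x ≠ y → 0 < Q (x - y)) (h : E →ᵃ[ℝ] ℝ) (hQ : ∀ x ∈ s, Q x = h x)
    {p : E} (hp : p ∈ convexHull ℝ (s : Set E)) : Q p ≤ h p ∧ (Q p = h p → p ∈ s) := by
  rw [Finset.convexHull_eq] at hp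
  obtain ⟨w, hw0, hw1, rfl⟩ := hp
  have hhp : h (s.centerMass w id) = ∑ x ∈ s, w x * Q x := by
    rw [← affineCombination_eq_centerMass hw1, Finset.map_affineCombination _ _ _ hw1,
      Finset.affineCombination_eq_linear_combination _ _ _ hw1]
    exact Finset.sum_congr rfl fun x hx => by simp [hQ x hx]
  have hc : s.centerMass w id = ∑ x ∈ s, w x • x := by
    rw [Finset.centerMass_eq_of_sum_1 _ _ hw1]; rfl
  have hvar := Q.sum_mul_mul_map_sub s w hw1
  rw [← hhp, ← hc] at hvar
  have hterm : ∀ x ∈ s, ∀ y ∈ s, 0 ≤ w x * w y * Q (x - y) := by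
    intro x hx y hy
    by_cases hxy : x = y
    · simp [hxy]
    · exact mul_nonneg (mul_nonneg (hw0 x hx) (hw0 y hy)) (hs x hx y hy hxy).le
  have hnonneg := Finset.sum_nonneg fun x hx => Finset.sum_nonneg (hterm x hx)
  refine ⟨by linarith, fun heq => ?_⟩
  rw [heq, sub_self, mul_zero] at hvar
  have hz := fun x hx => (Finset.sum_eq_zero_iff_of_nonneg (hterm x hx)).1
    ((Finset.sum_eq_zero_iff_of_nonneg fun x hx => Finset.sum_nonneg (hterm x hx)).1 hvar x hx)
  -- Products of weights at distinct points vanish, so one point carries all the mass.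
  obtain ⟨v, hv, hwv⟩ : ∃ v ∈ s, w v ≠ 0 := by
    by_contra! hcon
    rw [Finset.sum_eq_zero hcon] at hw1
    exact zero_ne_one hw1
  have hother : ∀ y ∈ s, y ≠ v → w y = 0 := by
    intro y hy hyv
    have h0 := hz v hv y hy
    have := (hs v hv y hy hyv.symm).ne'
    simpa [hwv, this] using h0
  have hwv1 : w v = 1 := by
    rw [← hw1]; exact (Finset.sum_eq_single_of_mem v hv hother).symm
  rw [hc, Finset.sum_eq_single_of_mem v hv fun y hy hyv => by rw [hother y hy hyv, zero_smul],
    hwv1, one_smul]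
  exact hv

end QuadraticForms

/-! ### Interiors and boundaries of `Q`-balls -/

section QBall

variable {d : ℕ} {Q : QuadraticForm ℝ (RSpace d)}

theorem QuadraticMap.continuous_of_rSpace (Q : QuadraticForm ℝ (RSpace d)) : Continuous Q := by
  have h : (Q : RSpace d → ℝ)
      = fun x => 2⁻¹ * (QuadraticMap.polarBilin Q).toContinuousBilinearMap x x := by
    ext x
    rw [LinearMap.toContinuousBilinearMap_apply, QuadraticMap.polarBilin_apply_apply,
      QuadraticMap.polar_self]
    simp
  rw [h]
  fun_prop

theorem AffineMap.continuous_of_rSpace (h : RSpace d →ᵃ[ℝ] ℝ) : Continuous h :=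
  h.continuous_of_finiteDimensional

theorem isQBall_iff_exists_affineMap {B : Set (RSpace d)} :
    IsQBall Q B ↔ ∃ h : RSpace d →ᵃ[ℝ] ℝ, B = {x | Q x ≤ h x} := by
  constructor
  · rintro ⟨φ, D, rfl⟩
    exact ⟨φ.toAffineMap + AffineMap.const ℝ _ D, by ext x; simp [qBall]⟩
  · rintro ⟨h, rfl⟩
    refine ⟨h.linear, h 0, ?_⟩
    ext x
    have := congrFun h.decomp x
    simp only [Pi.add_apply] at this
    simp [qBall, this]

/-- At an interior point with `Q x = h x`, adding the inequalities at `x ± t • u` cancels the linear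
terms and leaves `t² Q u ≤ 0`. -/
theorem interior_setOf_le_affineMap {u : RSpace d} (hu : 0 < Q u) (h : RSpace d →ᵃ[ℝ] ℝ) :
    interior {x | Q x ≤ h x} = {x | Q x < h x} := by
  apply Set.Subset.antisymm
  · intro x hx
    have hxB : Q x ≤ h x := interior_subset (s := {x | Q x ≤ h x}) hx
    refine lt_of_le_of_ne hxB fun heq => ?_
    have hplus : ∀ᶠ t : ℝ in nhds 0, Q (x + t • u) ≤ h (x + t • u) := by
      have hc : Continuous fun t : ℝ => x + t • u := by fun_prop
      have := hc.tendsto 0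
      simp only [zero_smul, add_zero] at this
      exact this.eventually (mem_interior_iff_mem_nhds.1 hx)
    have hminus : ∀ᶠ t : ℝ in nhds 0, Q (x - t • u) ≤ h (x - t • u) := by
      have hc : Continuous fun t : ℝ => x - t • u := by fun_prop
      have := hc.tendsto 0
      simp only [zero_smul, sub_zero] at this
      exact this.eventually (mem_interior_iff_mem_nhds.1 hx)
    obtain ⟨t, ⟨h1, h2⟩, ht⟩ := (((hplus.and hminus).filter_mono nhdsWithin_le_nhds).and
      (self_mem_nhdsWithin : Set.Ioi (0 : ℝ) ∈ nhdsWithin 0 (Set.Ioi 0))).exists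
    have hQ1 : Q (x + t • u) = Q x + t * t * Q u + QuadraticMap.polar Q x (t • u) := by
      simp [QuadraticMap.polar, QuadraticMap.map_smul]
    have hQ2 : Q (x - t • u) = Q x + t * t * Q u - QuadraticMap.polar Q x (t • u) := by
      rw [QuadraticMap.map_sub_eq, QuadraticMap.map_smul, smul_eq_mul]
    have hh1 : h (x + t • u) = h x + h.linear (t • u) := by
      rw [add_comm x, ← vadd_eq_add, h.map_vadd, vadd_eq_add, add_comm]
    have hh2 : h (x - t • u) = h x - h.linear (t • u) := by
      rw [sub_eq_neg_add, ← vadd_eq_add, h.map_vadd, vadd_eq_add, map_neg]; ring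
    have : 0 < t * t * Q u := mul_pos (mul_pos ht ht) hu
    linarith
  · exact interior_maximal (fun x (hx : Q x < h x) => hx.le)
      (isOpen_lt Q.continuous_of_rSpace h.continuous_of_rSpace)

theorem frontier_setOf_le_affineMap {u : RSpace d} (hu : 0 < Q u) (h : RSpace d →ᵃ[ℝ] ℝ) :
    frontier {x | Q x ≤ h x} = {x | Q x = h x} := by
  rw [(isClosed_le Q.continuous_of_rSpace h.continuous_of_rSpace).frontier_eq,
    interior_setOf_le_affineMap hu]
  ext x
  simp only [Set.mem_sdiff, Set.mem_ofPred_eq, not_lt]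
  exact le_antisymm_iff.symm

theorem SpacelikePosition.exists_pos {X : Finset (RSpace d)} (hX : SpacelikePosition Q X)
    (hcard : 1 < X.card) : ∃ u, 0 < Q u := by
  obtain ⟨x, hx, y, hy, hxy⟩ := Finset.one_lt_card.1 hcard
  exact ⟨x - y, hX x hx y hy hxy⟩

end QBall

/-! ### Cells from contact sets -/

section DelaunayCells

variable {d : ℕ} {Q : QuadraticForm ℝ (RSpace d)} {X : Finset (RSpace d)}

open Classical in
/-- The points of `X` at which the affine function `h` agrees with `Q`. -/
noncomputable def contactSet (Q : QuadraticForm ℝ (RSpace d)) (X : Finset (RSpace d))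
    (h : RSpace d →ᵃ[ℝ] ℝ) : Finset (RSpace d) :=
  X.filter fun x => Q x = h x

theorem mem_contactSet {h : RSpace d →ᵃ[ℝ] ℝ} {x : RSpace d} :
    x ∈ contactSet Q X h ↔ x ∈ X ∧ Q x = h x := by
  simp [contactSet]

theorem contactSet_subset {h : RSpace d →ᵃ[ℝ] ℝ} : contactSet Q X h ⊆ X :=
  fun _ hx => (mem_contactSet.1 hx).1

/-- The convex hulls of the nonempty contact sets of the affine functions below `Q` on `X`. -/
def delaunayCells (Q : QuadraticForm ℝ (RSpace d)) (X : Finset (RSpace d)) :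
    Set (Set (RSpace d)) :=
  {c | ∃ h : RSpace d →ᵃ[ℝ] ℝ, (∀ x ∈ X, h x ≤ Q x) ∧ (contactSet Q X h).Nonempty ∧
    c = convexHull ℝ (contactSet Q X h : Set (RSpace d))}

/-- An affine function below `Q` can be increased slightly along an affine function `l`
if `l` is nonpositive on the contact set. -/
theorem exists_perturbation {h : RSpace d →ᵃ[ℝ] ℝ} (hh : ∀ x ∈ X, h x ≤ Q x)
    (l : RSpace d →ᵃ[ℝ] ℝ) (hl : ∀ x ∈ contactSet Q X h, l x ≤ 0) :
    ∃ ε : ℝ, 0 < ε ∧ (∀ x ∈ X, (h + ε • l) x ≤ Q x) ∧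
      ∀ x, x ∈ contactSet Q X (h + ε • l) ↔ x ∈ contactSet Q X h ∧ l x = 0 := by
  have hev : ∀ᶠ ε : ℝ in nhdsWithin 0 (Set.Ioi 0), ∀ x ∈ X, x ∉ contactSet Q X h →
      (h + ε • l) x < Q x := by
    rw [Filter.eventually_all_finset]
    intro x hx
    by_cases hxc : x ∈ contactSet Q X h
    · exact Filter.Eventually.of_forall fun ε hcon => absurd hxc hcon
    · have hlt : h x < Q x := lt_of_le_of_ne (hh x hx)
        fun heq => hxc (mem_contactSet.2 ⟨hx, heq.symm⟩)
      have hc : Continuous fun ε : ℝ => h x + ε * l x := by fun_prop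
      have ht := hc.tendsto 0
      simp only [zero_mul, add_zero] at ht
      filter_upwards [nhdsWithin_le_nhds (ht.eventually (gt_mem_nhds hlt))] with ε hε _
      simpa using hε
  obtain ⟨ε, hε, hpos⟩ := (hev.and
    (self_mem_nhdsWithin : Set.Ioi (0 : ℝ) ∈ nhdsWithin 0 (Set.Ioi 0))).exists
  have hpos : 0 < ε := hpos
  have happ : ∀ x, (h + ε • l) x = h x + ε * l x := fun x => by simp
  refine ⟨ε, hpos, fun x hx => ?_, fun x => ⟨fun hx => ?_, fun ⟨hx, hx0⟩ => ?_⟩⟩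
  · by_cases hxc : x ∈ contactSet Q X h
    · rw [happ]
      have := mul_nonpos_of_nonneg_of_nonpos hpos.le (hl x hxc)
      linarith [hh x hx]
    · exact (hε x hx hxc).le
  · obtain ⟨hxX, hxQ⟩ := mem_contactSet.1 hx
    have hxc : x ∈ contactSet Q X h := by
      by_contra hxc
      exact (hε x hxX hxc).ne hxQ.symm
    refine ⟨hxc, ?_⟩
    rw [happ, (mem_contactSet.1 hxc).2] at hxQ
    exact (mul_eq_zero.1 (by linarith : ε * l x = 0)).resolve_left hpos.ne'
  · obtain ⟨hxX, hxQ⟩ := mem_contactSet.1 hx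
    refine mem_contactSet.2 ⟨hxX, ?_⟩
    rw [happ, hx0, mul_zero, add_zero, hxQ]

theorem convexHull_mem_delaunayCells {h : RSpace d →ᵃ[ℝ] ℝ} (hh : ∀ x ∈ X, h x ≤ Q x)
    (l : RSpace d →ᵃ[ℝ] ℝ) (hl : ∀ x ∈ contactSet Q X h, l x ≤ 0)
    (hne : {x | x ∈ contactSet Q X h ∧ l x = 0}.Nonempty) :
    convexHull ℝ {x | x ∈ contactSet Q X h ∧ l x = 0} ∈ delaunayCells Q X := by
  obtain ⟨ε, -, hle, hmem⟩ := exists_perturbation hh l hl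
  have heq : (contactSet Q X (h + ε • l) : Set (RSpace d))
      = {x | x ∈ contactSet Q X h ∧ l x = 0} := Set.ext hmem
  refine ⟨h + ε • l, hle, ?_, by rw [heq]⟩
  rw [← Finset.coe_nonempty, heq]
  exact hne

theorem delaunayCells_finite : (delaunayCells Q X).Finite := by
  refine ((X.powerset.finite_toSet).image
    fun s : Finset (RSpace d) => convexHull ℝ (s : Set (RSpace d))).subset ?_
  rintro c ⟨h, -, -, rfl⟩
  exact ⟨contactSet Q X h, by simpa using contactSet_subset, rfl⟩

theorem mem_delaunayCells_of_isExposed {c f : Set (RSpace d)} (hc : c ∈ delaunayCells Q X)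
    (hne : f.Nonempty) (hf : IsExposed ℝ c f) : f ∈ delaunayCells Q X := by
  obtain ⟨h, hh, hV, rfl⟩ := hc
  obtain ⟨l, hl⟩ := hf hne
  obtain ⟨p, hp⟩ := hne
  have hp' := hp
  rw [hl] at hp'
  set a : RSpace d →ᵃ[ℝ] ℝ :=
    (l : RSpace d →ₗ[ℝ] ℝ).toAffineMap - AffineMap.const ℝ _ (l p) with ha
  have happ : ∀ x, a x = l x - l p := fun x => by simp [ha]
  have hle : ∀ x ∈ contactSet Q X h, a x ≤ 0 := fun x hx => by
    rw [happ]; linarith [hp'.2 x (subset_convexHull ℝ _ hx)]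
  have key := (contactSet Q X h).convexHull_inter_affine_eq a 0 hle
  have hfeq : f = {q | q ∈ convexHull ℝ (contactSet Q X h : Set (RSpace d)) ∧ a q = 0} := by
    rw [hl]
    ext q
    simp only [Set.mem_ofPred_eq, happ]
    refine and_congr_right fun hq => ⟨fun hmax => ?_, fun h0 y hy => ?_⟩
    · linarith [hmax p hp'.1, hp'.2 q hq]
    · linarith [hp'.2 y hy]
  have hfeq' := hfeq.trans key
  rw [hfeq']
  refine convexHull_mem_delaunayCells hh a hle ?_
  rw [← convexHull_nonempty_iff (𝕜 := ℝ), ← hfeq']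
  exact ⟨p, hp⟩

/-- The difference `h' - h` is nonpositive on `c` and nonnegative on `c'`, so the intersection is
its zero locus in `c`. -/
theorem isExposed_inter_of_mem_delaunayCells {c c' : Set (RSpace d)}
    (hc : c ∈ delaunayCells Q X) (hc' : c' ∈ delaunayCells Q X) : IsExposed ℝ c (c ∩ c') := by
  obtain ⟨h, hh, hV, rfl⟩ := hc
  obtain ⟨h', hh', hV', rfl⟩ := hc'
  set a : RSpace d →ᵃ[ℝ] ℝ := h' - h with ha
  have happ : ∀ x, a x = h' x - h x := fun x => by simp [ha]
  have hle : ∀ x ∈ contactSet Q X h, a x ≤ 0 := fun x hx => by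
    obtain ⟨hxX, hxQ⟩ := mem_contactSet.1 hx
    rw [happ]; linarith [hh' x hxX]
  have hneg : ∀ x, (-a) x = -a x := fun x => rfl
  have hle' : ∀ x ∈ contactSet Q X h', (-a) x ≤ 0 := fun x hx => by
    obtain ⟨hxX, hxQ⟩ := mem_contactSet.1 hx
    rw [hneg, happ]; linarith [hh x hxX]
  have key := (contactSet Q X h).convexHull_inter_affine_eq a 0 hle
  have hinter : convexHull ℝ (contactSet Q X h : Set (RSpace d))
        ∩ convexHull ℝ (contactSet Q X h' : Set (RSpace d))
      = {q | q ∈ convexHull ℝ (contactSet Q X h : Set (RSpace d)) ∧ a q = 0} := by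
    ext q
    constructor
    · rintro ⟨hq, hq'⟩
      have h1 := le_of_mem_convexHull_of_le _ _ _ hle hq
      have h2 := le_of_mem_convexHull_of_le _ _ _ hle' hq'
      rw [hneg] at h2
      exact ⟨hq, by linarith⟩
    · intro hq
      refine ⟨hq.1, ?_⟩
      rw [key] at hq
      refine convexHull_mono ?_ hq
      rintro x ⟨hx, hx0⟩
      obtain ⟨hxX, hxQ⟩ := mem_contactSet.1 hx
      rw [happ] at hx0
      exact mem_contactSet.2 ⟨hxX, by linarith⟩
  rw [hinter]
  rintro ⟨p, hp, hp0⟩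
  have hlin : ∀ x, a x = a.linear x + a 0 := fun x => congrFun a.decomp x
  refine ⟨LinearMap.toContinuousLinearMap a.linear, ?_⟩
  ext q
  simp only [Set.mem_ofPred_eq, LinearMap.coe_toContinuousLinearMap']
  refine and_congr_right fun hq => ⟨fun h0 y hy => ?_, fun hmax => ?_⟩
  · have := le_of_mem_convexHull_of_le _ _ _ hle hy
    linarith [hlin y, hlin q]
  · have := le_of_mem_convexHull_of_le _ _ _ hle hq
    linarith [hlin p, hlin q, hmax p hp]

/-- A contact point is in the hull of the extreme points and satisfies `Q = h`, so the equality case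
of the variance bound makes it one of them. -/
theorem extremePoints_convexHull_contactSet (hX : SpacelikePosition Q X)
    (h : RSpace d →ᵃ[ℝ] ℝ) :
    (convexHull ℝ (contactSet Q X h : Set (RSpace d))).extremePoints ℝ = contactSet Q X h := by
  refine Set.Subset.antisymm extremePoints_convexHull_subset fun v hv => ?_
  set V := contactSet Q X h
  have hfin : ((convexHull ℝ (V : Set (RSpace d))).extremePoints ℝ).Finite :=
    V.finite_toSet.subset extremePoints_convexHull_subset
  have hsub : ∀ x ∈ hfin.toFinset, x ∈ V := fun x hx =>
    extremePoints_convexHull_subset (hfin.mem_toFinset.1 hx)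
  have hvc : v ∈ convexHull ℝ (hfin.toFinset : Set (RSpace d)) := by
    rw [hfin.coe_toFinset, convexHull_extremePoints_convexHull]
    exact subset_convexHull ℝ _ hv
  exact hfin.mem_toFinset.1 ((Q.le_affine_of_mem_convexHull hfin.toFinset
    (fun x hx y hy => hX x (contactSet_subset (hsub x hx)) y (contactSet_subset (hsub y hy))) h
    (fun x hx => (mem_contactSet.1 (hsub x hx)).2) hvc).2 (mem_contactSet.1 hv).2)

theorem exists_isEmptyCircumball (hX : SpacelikePosition Q X) (hcard : 1 < X.card)
    {c : Set (RSpace d)} (hc : c ∈ delaunayCells Q X) : ∃ B, IsEmptyCircumball Q X c B := by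
  obtain ⟨h, hh, -, rfl⟩ := hc
  obtain ⟨u, hu⟩ := hX.exists_pos hcard
  have hC : ∀ p ∈ convexHull ℝ (contactSet Q X h : Set (RSpace d)),
      Q p ≤ h p ∧ (Q p = h p → p ∈ contactSet Q X h) := fun p hp =>
    Q.le_affine_of_mem_convexHull (contactSet Q X h)
      (fun x hx y hy => hX x (contactSet_subset hx) y (contactSet_subset hy)) h
      (fun x hx => (mem_contactSet.1 hx).2) hp
  refine ⟨{x | Q x ≤ h x}, isQBall_iff_exists_affineMap.2 ⟨h, rfl⟩,
    ⟨fun p hp => (hC p hp).1, ?_⟩, fun x hx => ?_⟩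
  · rw [extremePoints_convexHull_contactSet hX, frontier_setOf_le_affineMap hu]
    exact Set.Subset.antisymm (fun p hp => (hC p hp.1).2 hp.2)
      fun p hp => ⟨subset_convexHull ℝ _ hp, (mem_contactSet.1 hp).2⟩
  · rw [interior_setOf_le_affineMap hu]
    exact not_lt.2 (hh x hx)

/-- The affine function describing an empty circumscribed `Q`-ball. -/
theorem IsEmptyCircumball.exists_affineMap {u : RSpace d} (hu : 0 < Q u) {c B : Set (RSpace d)}
    (hB : IsEmptyCircumball Q X c B) : ∃ h : RSpace d →ᵃ[ℝ] ℝ, B = {x | Q x ≤ h x} ∧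
      (∀ x ∈ X, h x ≤ Q x) ∧ ∀ x ∈ c.extremePoints ℝ, Q x = h x := by
  obtain ⟨hball, hins, hempty⟩ := hB
  obtain ⟨h, rfl⟩ := isQBall_iff_exists_affineMap.1 hball
  refine ⟨h, rfl, fun x hx => ?_, fun x hx => ?_⟩
  · have := hempty x hx
    rw [interior_setOf_le_affineMap hu] at this
    exact not_lt.1 this
  · rw [← hins.2, frontier_setOf_le_affineMap hu] at hx
    exact hx.2

theorem IsEmptyCircumball.eq {u : RSpace d} (hu : 0 < Q u) (s : Finset (RSpace d))
    (hs : affineSpan ℝ (convexHull ℝ (s : Set (RSpace d))) = ⊤) {B B' : Set (RSpace d)}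
    (hB : IsEmptyCircumball Q X (convexHull ℝ (s : Set (RSpace d))) B)
    (hB' : IsEmptyCircumball Q X (convexHull ℝ (s : Set (RSpace d))) B') : B = B' := by
  obtain ⟨h, rfl, -, hh⟩ := hB.exists_affineMap hu
  obtain ⟨h', rfl, -, hh'⟩ := hB'.exists_affineMap hu
  rw [← convexHull_extremePoints_convexHull, affineSpan_convexHull] at hs
  rw [AffineMap.ext_on hs fun x hx => (hh x hx).symm.trans (hh' x hx)]

theorem zeroSkeleton_delaunayCells (hX : SpacelikePosition Q X) :
    zeroSkeleton (delaunayCells Q X) = (X : Set (RSpace d)) := by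
  ext x
  constructor
  · rintro ⟨h, -, ⟨v, hv⟩, hc⟩
    have hvx : v ∈ ({x} : Set (RSpace d)) := by
      rw [hc]; exact subset_convexHull ℝ _ hv
    rw [← Set.mem_singleton_iff.1 hvx]
    exact contactSet_subset hv
  · intro hx
    -- The tangent function of `Q` at `x`, whose gap below `Q` at `y` is `Q (x - y)`.
    set h : RSpace d →ᵃ[ℝ] ℝ :=
      (QuadraticMap.polarBilin Q x).toAffineMap - AffineMap.const ℝ _ (Q x) with hdef
    have happ : ∀ y, Q y - h y = Q (x - y) := fun y => by
      rw [QuadraticMap.map_sub_eq, hdef]; simp; ring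
    have hV : contactSet Q X h = {x} := by
      ext y
      rw [mem_contactSet, Finset.mem_singleton]
      constructor
      · rintro ⟨hy, hyQ⟩
        by_contra hyx
        have := hX x hx y hy (Ne.symm hyx)
        rw [← happ] at this
        linarith
      · rintro rfl
        refine ⟨hx, ?_⟩
        have := happ y
        rw [sub_self, QuadraticMap.map_zero] at this
        linarith
    refine ⟨h, fun y hy => ?_, ?_, ?_⟩
    · rcases eq_or_ne x y with rfl | hxy
      · have := happ x
        rw [sub_self, QuadraticMap.map_zero] at this
        linarith
      · have := hX x hx y hy hxy
        rw [← happ] at this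
        linarith
    · rw [hV]; exact Finset.singleton_nonempty x
    · rw [hV]; simp

end DelaunayCells

/-! ### Consequences of genericity -/

section Generic

variable {d : ℕ} {Q : QuadraticForm ℝ (RSpace d)} {X : Finset (RSpace d)}

theorem GenericPosition.affineSpan_eq_top (hgen : GenericPosition Q X) {s : Finset (RSpace d)}
    (hs : s ⊆ X) (hcard : s.card = d + 1) : affineSpan ℝ (s : Set (RSpace d)) = ⊤ := by
  obtain ⟨p, hp⟩ : s.Nonempty := by rw [← Finset.card_pos]; omega
  by_contra htop
  have hdir : (affineSpan ℝ (s : Set (RSpace d))).direction < ⊤ := by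
    rw [lt_top_iff_ne_top]
    exact fun h => htop ((AffineSubspace.direction_eq_top_iff_of_nonempty
      ⟨p, subset_affineSpan ℝ _ hp⟩).1 h)
  obtain ⟨l, hl0, hl⟩ := Submodule.exists_le_ker_of_lt_top _ hdir
  refine hgen.1 s hs hcard {x | l x = l p} ⟨l, l p, hl0, rfl⟩ fun x hx => ?_
  have := hl (AffineSubspace.vsub_mem_direction (subset_affineSpan ℝ _ hx)
    (subset_affineSpan ℝ _ hp))
  rw [LinearMap.mem_ker, vsub_eq_sub, map_sub, sub_eq_zero] at this
  exact this

theorem GenericPosition.card_contactSet_le (hgen : GenericPosition Q X)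
    (hX : SpacelikePosition Q X) (hcard : 1 < X.card) (h : RSpace d →ᵃ[ℝ] ℝ) :
    (contactSet Q X h).card ≤ d + 1 := by
  by_contra hlt
  obtain ⟨u, hu⟩ := hX.exists_pos hcard
  obtain ⟨s, hs, hscard⟩ := Finset.exists_subset_card_eq (s := contactSet Q X h) (n := d + 2)
    (by omega)
  refine hgen.2 s (hs.trans contactSet_subset) hscard (frontier {x | Q x ≤ h x})
    ⟨_, isQBall_iff_exists_affineMap.2 ⟨h, rfl⟩, rfl⟩ fun x hx => ?_
  rw [frontier_setOf_le_affineMap hu]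
  exact (mem_contactSet.1 (hs hx)).2

/-- In generic position any subset of at most `d + 1` points has the subset vanishing locus of
an affine function that is nonpositive on it. -/
theorem GenericPosition.exists_affineMap_vanishing (hgen : GenericPosition Q X)
    (hcard : d + 1 ≤ X.card) {V : Finset (RSpace d)} (hV : V ⊆ X) (hVcard : V.card ≤ d + 1)
    (W : Set (RSpace d)) :
    ∃ l : RSpace d →ᵃ[ℝ] ℝ, ∀ x ∈ V, l x ≤ 0 ∧ (l x = 0 ↔ x ∈ W) := by
  classical
  obtain ⟨V', hVV', hV'X, hV'card⟩ := Finset.exists_subsuperset_card_eq hV hVcard hcard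
  have htop := hgen.affineSpan_eq_top hV'X hV'card
  obtain ⟨s, hs, b, hb⟩ := AffineBasis.exists_affine_subbasis htop
  have hsfin : s.Finite := V'.finite_toSet.subset hs
  have : Fintype s := hsfin.fintype
  -- An affine basis has `d + 1` elements, so no point was dropped.
  have hsV' : s = (V' : Set (RSpace d)) := by
    refine Set.eq_of_subset_of_ncard_le hs ?_ V'.finite_toSet
    rw [Set.ncard_coe_finset, hV'card, ← Nat.card_coe_set_eq, Nat.card_eq_fintype_card,
      b.card_eq_finrank_add_one, finrank_euclideanSpace_fin]
  -- Minus the barycentric coordinates of the points off `W`: value `0` on `W`, `-1` elsewhere in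
  -- `V'`.
  refine ⟨-∑ i ∈ Finset.univ.filter (fun i : s => (i : RSpace d) ∉ W), b.coord i, ?_⟩
  intro x hx
  have hxs : x ∈ s := by rw [hsV']; exact hVV' hx
  have hbx : b ⟨x, hxs⟩ = x := by rw [hb]
  have hval : (-∑ i ∈ Finset.univ.filter (fun i : s => (i : RSpace d) ∉ W), b.coord i) x
      = if x ∈ W then 0 else -1 := by
    have h1 : (-∑ i ∈ Finset.univ.filter (fun i : s => (i : RSpace d) ∉ W), b.coord i) x
        = -∑ i ∈ Finset.univ.filter (fun i : s => (i : RSpace d) ∉ W), b.coord i x := by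
      rw [show ∀ f : RSpace d →ᵃ[ℝ] ℝ, (-f) x = -f x from fun f => rfl]
      congr 1
      induction Finset.univ.filter (fun i : s => (i : RSpace d) ∉ W) using Finset.induction_on with
      | empty => simp
      | insert a t ha ih => rw [Finset.sum_insert ha, Finset.sum_insert ha, ← ih]; rfl
    rw [h1]
    have h2 : ∀ i : s, b.coord i x = if i = ⟨x, hxs⟩ then 1 else 0 := fun i => by
      conv_lhs => rw [← hbx]
      exact b.coord_apply i ⟨x, hxs⟩
    simp only [h2]
    rw [Finset.sum_ite_eq']
    by_cases hxW : x ∈ W <;> simp [hxW]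
  rw [hval]
  by_cases hxW : x ∈ W <;> simp [hxW]

theorem GenericPosition.convexHull_subset_contactSet_mem (hgen : GenericPosition Q X)
    (hX : SpacelikePosition Q X) (hcard : d + 1 ≤ X.card) (hcard' : 1 < X.card)
    {h : RSpace d →ᵃ[ℝ] ℝ} (hh : ∀ x ∈ X, h x ≤ Q x) {W : Set (RSpace d)} (hW : W.Nonempty)
    (hWV : W ⊆ contactSet Q X h) : convexHull ℝ W ∈ delaunayCells Q X := by
  obtain ⟨l, hl⟩ := hgen.exists_affineMap_vanishing hcard contactSet_subset
    (hgen.card_contactSet_le hX hcard' h) W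
  have hWeq : {x | x ∈ contactSet Q X h ∧ l x = 0} = W := by
    ext x
    exact ⟨fun hx => (hl x hx.1).2.1 hx.2, fun hx => ⟨hWV hx, (hl x (hWV hx)).2.2 hx⟩⟩
  have := convexHull_mem_delaunayCells hh l (fun x hx => (hl x hx).1) (by rwa [hWeq])
  rwa [hWeq] at this

/-! ### Covering the convex hull -/

/-- Among the affine functions below `Q` on `X` some one is maximal at a given interior point
of the convex hull. -/
theorem exists_affineMap_isMax {p : RSpace d}
    (hp : p ∈ interior (convexHull ℝ (X : Set (RSpace d)))) :
    ∃ h : RSpace d →ᵃ[ℝ] ℝ, (∀ x ∈ X, h x ≤ Q x) ∧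
      ∀ h' : RSpace d →ᵃ[ℝ] ℝ, (∀ x ∈ X, h' x ≤ Q x) → h' p ≤ h p := by
  have hne : X.Nonempty := by
    rw [← Finset.coe_nonempty, ← convexHull_nonempty_iff (𝕜 := ℝ)]
    exact ⟨p, interior_subset hp⟩
  obtain ⟨y, hy, hymin⟩ := X.exists_min_image Q hne
  obtain ⟨z, hz, hzmax⟩ := X.exists_max_image Q hne
  -- A pair encodes `q ↦ f.1 (q - p) + f.2`, with value `f.2` at `p`. The lower bound `Q y = min Q`
  -- on that value makes `A` compact; a ball around `p` in the hull bounds the slope.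
  set A : Set (StrongDual ℝ (RSpace d) × ℝ) :=
    {f | (∀ x ∈ X, f.1 (x - p) + f.2 ≤ Q x) ∧ Q y ≤ f.2} with hA
  have hAclosed : IsClosed A := by
    have h1 : IsClosed {f : StrongDual ℝ (RSpace d) × ℝ | ∀ x ∈ X, f.1 (x - p) + f.2 ≤ Q x} := by
      simp only [Set.ofPred_forall]
      refine isClosed_biInter fun x _ => isClosed_le ?_ continuous_const
      exact ((ContinuousLinearMap.apply ℝ ℝ (x - p)).continuous.comp continuous_fst).add
        continuous_snd
    exact h1.inter (isClosed_le continuous_const continuous_snd)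
  have hbound : ∀ f ∈ A, ∀ q ∈ convexHull ℝ (X : Set (RSpace d)), f.1 (q - p) + f.2 ≤ Q z := by
    intro f hf q hq
    have := le_of_mem_convexHull_of_le (X : Set (RSpace d))
      ((f.1 : RSpace d →ₗ[ℝ] ℝ).toAffineMap + AffineMap.const ℝ _ (f.2 - f.1 p)) (Q z)
      (fun x hx => by
        have h1 := hf.1 x hx
        have h2 := hzmax x hx
        rw [map_sub] at h1
        simp
        linarith) hq
    simp at this
    rw [map_sub]
    linarith
  obtain ⟨r, hr, hball⟩ := Metric.nhds_basis_closedBall.mem_iff.1 (mem_interior_iff_mem_nhds.1 hp)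
  have hAbdd : Bornology.IsBounded A := by
    refine ((Metric.isBounded_closedBall (x := (0 : StrongDual ℝ (RSpace d)))
      (r := (Q z - Q y) / r)).prod (Metric.isBounded_Icc (Q y) (Q z))).subset ?_
    intro f hf
    have hf2 : f.2 ≤ Q z := by simpa using hbound f hf p (interior_subset hp)
    refine ⟨?_, hf.2, hf2⟩
    rw [mem_closedBall_zero_iff]
    have hyz : 0 ≤ Q z - Q y := sub_nonneg.2 (hzmax y hy)
    refine f.1.opNorm_le_of_unit_norm (by positivity) fun v hv => ?_
    have key : ∀ w : RSpace d, ‖w‖ = 1 → f.1 w ≤ (Q z - Q y) / r := by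
      intro w hw
      have hmem : p + r • w ∈ Metric.closedBall p r := by
        rw [Metric.mem_closedBall, dist_eq_norm, add_sub_cancel_left, norm_smul, hw,
          Real.norm_of_nonneg hr.le, mul_one]
      have := hbound f hf _ (hball hmem)
      rw [add_sub_cancel_left, map_smul, smul_eq_mul] at this
      rw [le_div_iff₀ hr]
      linarith [hf.2]
    rw [Real.norm_eq_abs, abs_le]
    have h1 := key (-v) (by rw [norm_neg, hv])
    rw [map_neg] at h1
    exact ⟨by linarith, key v hv⟩
  have hAcomp : IsCompact A := Metric.isCompact_of_isClosed_isBounded hAclosed hAbdd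
  have hAne : A.Nonempty := ⟨(0, Q y), fun x hx => by simpa using hymin x hx, le_rfl⟩
  obtain ⟨f, hfA, hfmax⟩ := hAcomp.exists_isMaxOn hAne
    (f := Prod.snd) continuous_snd.continuousOn
  refine ⟨(f.1 : RSpace d →ₗ[ℝ] ℝ).toAffineMap + AffineMap.const ℝ _ (f.2 - f.1 p),
    fun x hx => ?_, fun h' hh' => ?_⟩
  · have h1 := hfA.1 x hx
    rw [map_sub] at h1
    simp
    linarith
  · have hval : ((f.1 : RSpace d →ₗ[ℝ] ℝ).toAffineMap
        + AffineMap.const ℝ (RSpace d) (f.2 - f.1 p) : RSpace d →ᵃ[ℝ] ℝ) p = f.2 := by simp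
    rw [hval]
    by_cases hlow : Q y ≤ h' p
    · refine hfmax (a := (LinearMap.toContinuousLinearMap h'.linear, h' p))
        ⟨fun x hx => ?_, hlow⟩
      have := h'.linearMap_vsub x p
      simp only [vsub_eq_sub] at this
      simp only [LinearMap.coe_toContinuousLinearMap']
      rw [this]
      linarith [hh' x hx]
    · exact (not_le.1 hlow).le.trans hfA.2

theorem exists_mem_delaunayCells_of_mem_interior {p : RSpace d}
    (hp : p ∈ interior (convexHull ℝ (X : Set (RSpace d)))) : ∃ c ∈ delaunayCells Q X, p ∈ c := by
  obtain ⟨h, hh, hmax⟩ := exists_affineMap_isMax (Q := Q) hp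
  have hpV : p ∈ convexHull ℝ (contactSet Q X h : Set (RSpace d)) := by
    by_contra hpV
    obtain ⟨l, u, hlu, hu⟩ := geometric_hahn_banach_closed_point (convex_convexHull ℝ _)
      ((contactSet Q X h).finite_toSet.isClosed_convexHull ℝ) hpV
    set a : RSpace d →ᵃ[ℝ] ℝ :=
      (l : RSpace d →ₗ[ℝ] ℝ).toAffineMap - AffineMap.const ℝ _ u with ha
    have happ : ∀ x, a x = l x - u := fun x => by simp [ha]
    obtain ⟨ε, hε, hle, -⟩ := exists_perturbation hh a fun x hx => by
      rw [happ]; linarith [hlu x (subset_convexHull ℝ _ hx)]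
    have h1 := hmax _ hle
    have h2 : (h + ε • a) p = h p + ε * (l p - u) := by simp [happ]
    have h3 := mul_pos hε (sub_pos.2 hu)
    linarith
  refine ⟨_, ⟨h, hh, ?_, rfl⟩, hpV⟩
  rw [← Finset.coe_nonempty, ← convexHull_nonempty_iff (𝕜 := ℝ)]
  exact ⟨p, hpV⟩

theorem GenericPosition.sUnion_delaunayCells (hgen : GenericPosition Q X)
    (hcard : d + 1 ≤ X.card) : ⋃₀ delaunayCells Q X = convexHull ℝ (X : Set (RSpace d)) := by
  apply Set.Subset.antisymm
  · rintro p ⟨c, ⟨h, -, -, rfl⟩, hp⟩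
    exact convexHull_mono (by exact_mod_cast contactSet_subset) hp
  · have hclosed : IsClosed (⋃₀ delaunayCells Q X) := by
      rw [Set.sUnion_eq_biUnion]
      refine delaunayCells_finite.isClosed_biUnion ?_
      rintro c ⟨h, -, -, rfl⟩
      exact (contactSet Q X h).finite_toSet.isClosed_convexHull ℝ
    obtain ⟨s, hsX, hscard⟩ := Finset.exists_subset_card_eq hcard
    have htop : affineSpan ℝ (X : Set (RSpace d)) = ⊤ := by
      rw [eq_top_iff, ← hgen.affineSpan_eq_top hsX hscard]
      exact affineSpan_mono ℝ (by exact_mod_cast hsX)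
    have hcl := Convex.closure_interior_eq_closure_of_nonempty_interior
      (convex_convexHull ℝ (X : Set (RSpace d))) (interior_convexHull_nonempty_iff_affineSpan_eq_top.2 htop)
    -- Finitely many closed cells have a closed union, so covering the interior suffices.
    refine subset_closure.trans ?_
    rw [← hcl]
    refine closure_minimal (fun p hp => ?_) hclosed
    obtain ⟨c, hc, hpc⟩ := exists_mem_delaunayCells_of_mem_interior (Q := Q) hp
    exact ⟨c, hc, hpc⟩

theorem isQDelaunay_delaunayCells (hX : SpacelikePosition Q X) (hgen : GenericPosition Q X)
    (hcard : d + 1 ≤ X.card) (hcard' : 1 < X.card) : IsQDelaunay Q X (delaunayCells Q X) where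
  cellDecomposition :=
    { finite := delaunayCells_finite
      polytope := by
        rintro c ⟨h, -, hV, rfl⟩
        exact ⟨_, hV, rfl⟩
      face_mem := fun c hc f hne hf => mem_delaunayCells_of_isExposed hc hne hf
      inter_face := fun c hc c' hc' => ⟨isExposed_inter_of_mem_delaunayCells hc hc',
        Set.inter_comm c c' ▸ isExposed_inter_of_mem_delaunayCells hc' hc⟩
      sUnion_eq := hgen.sUnion_delaunayCells hcard }
  zeroSkeleton_eq := zeroSkeleton_delaunayCells hX
  exists_ball := fun _ hc => exists_isEmptyCircumball hX hcard' hc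
  unique_ball := by
    intro c hc htop
    obtain ⟨u, hu⟩ := hX.exists_pos hcard'
    obtain ⟨B, hB⟩ := exists_isEmptyCircumball hX hcard' hc
    obtain ⟨h, -, -, rfl⟩ := hc
    exact ⟨B, hB, fun B' hB' => hB'.eq hu _ htop hB⟩

/-! ### Uniqueness of the decomposition -/

/-- The barycentre of a finite set lies in no proper exposed face of its convex hull. -/
theorem eq_convexHull_of_isExposed_of_barycentre_mem {s : Finset (RSpace d)} (hs : s.Nonempty)
    {f : Set (RSpace d)} (hf : IsExposed ℝ (convexHull ℝ (s : Set (RSpace d))) f)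
    (hp : ((s.card : ℝ)⁻¹ • ∑ x ∈ s, x) ∈ f) : f = convexHull ℝ (s : Set (RSpace d)) := by
  obtain ⟨l, hl⟩ := hf ⟨_, hp⟩
  set p := (s.card : ℝ)⁻¹ • ∑ x ∈ s, x with hpdef
  have hcard : (s.card : ℝ) ≠ 0 := by exact_mod_cast hs.card_pos.ne'
  rw [hl] at hp
  have hsum : ∑ x ∈ s, (l p - l x) = 0 := by
    rw [Finset.sum_sub_distrib, Finset.sum_const, nsmul_eq_mul, hpdef, map_smul, map_sum,
      smul_eq_mul, mul_inv_cancel_left₀ hcard, sub_self]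
  have hzero := (Finset.sum_eq_zero_iff_of_nonneg fun x hx =>
    sub_nonneg.2 (hp.2 x (subset_convexHull ℝ _ hx))).1 hsum
  have hconst : ∀ q ∈ convexHull ℝ (s : Set (RSpace d)), l q = l p := fun q hq =>
    convexHull_min (t := l ⁻¹' {l p}) (fun x hx => (sub_eq_zero.1 (hzero x hx)).symm)
      ((convex_singleton (l p)).is_linear_preimage l.toLinearMap.isLinear) hq
  rw [hl]
  ext q
  exact ⟨fun hq => hq.1, fun hq => ⟨hq, fun y hy => by rw [hconst y hy, hconst q hq]⟩⟩

theorem barycentre_mem_convexHull {s : Finset (RSpace d)} (hs : s.Nonempty) :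
    ((s.card : ℝ)⁻¹ • ∑ x ∈ s, x) ∈ convexHull ℝ (s : Set (RSpace d)) := by
  have hcard : (s.card : ℝ) ≠ 0 := by exact_mod_cast hs.card_pos.ne'
  rw [Finset.smul_sum]
  exact (convex_convexHull ℝ _).sum_mem (fun _ _ => by positivity)
    (by rw [Finset.sum_const, nsmul_eq_mul, mul_inv_cancel₀ hcard])
    fun x hx => subset_convexHull ℝ _ hx

theorem IsQDelaunay.subset_delaunayCells {K : Set (Set (RSpace d))} (hK : IsQDelaunay Q X K)
    (hX : SpacelikePosition Q X) (hgen : GenericPosition Q X)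
    (hcard : d + 1 ≤ X.card) (hcard' : 1 < X.card) : K ⊆ delaunayCells Q X := by
  intro c hc
  obtain ⟨u, hu⟩ := hX.exists_pos hcard'
  obtain ⟨B, hB⟩ := hK.exists_ball c hc
  obtain ⟨h, -, hh, hext⟩ := hB.exists_affineMap hu
  obtain ⟨s, hs, hcs⟩ := hK.cellDecomposition.polytope c hc
  have hconv : convexHull ℝ (c.extremePoints ℝ) = c := by
    rw [hcs]; exact convexHull_extremePoints_convexHull s
  have hne : (c.extremePoints ℝ).Nonempty := by
    rw [← convexHull_nonempty_iff (𝕜 := ℝ), hconv, hcs, convexHull_nonempty_iff]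
    exact_mod_cast hs
  rw [← hconv]
  refine hgen.convexHull_subset_contactSet_mem hX hcard hcard' hh hne fun v hv => ?_
  refine mem_contactSet.2 ⟨?_, hext v hv⟩
  have hvK : {v} ∈ K := by
    refine hK.cellDecomposition.face_mem c hc {v} (Set.singleton_nonempty v) ?_
    rw [hcs] at hv ⊢
    exact isExposed_singleton_of_mem_extremePoints s hv
  have : v ∈ zeroSkeleton K := hvK
  rwa [hK.zeroSkeleton_eq] at this

theorem IsQDelaunay.eq_delaunayCells {K : Set (Set (RSpace d))} (hK : IsQDelaunay Q X K)
    (hX : SpacelikePosition Q X) (hgen : GenericPosition Q X)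
    (hcard : d + 1 ≤ X.card) (hcard' : 1 < X.card) : K = delaunayCells Q X := by
  have hsub := hK.subset_delaunayCells hX hgen hcard hcard'
  refine Set.Subset.antisymm hsub fun c hc => ?_
  have hc' := hc
  obtain ⟨h, -, hV, rfl⟩ := hc'
  have hp := barycentre_mem_convexHull hV
  have hpK : ((contactSet Q X h).card : ℝ)⁻¹ • ∑ x ∈ contactSet Q X h, x ∈ ⋃₀ K := by
    rw [hK.cellDecomposition.sUnion_eq]
    exact convexHull_mono (by exact_mod_cast contactSet_subset) hp
  obtain ⟨c', hc', hpc'⟩ := hpK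
  -- The face of the candidate cell cut out by `c'` contains the barycentre, hence is the whole
  -- cell.
  have heq := eq_convexHull_of_isExposed_of_barycentre_mem hV
    (isExposed_inter_of_mem_delaunayCells hc (hsub hc')) ⟨hp, hpc'⟩
  refine hK.cellDecomposition.face_mem c' hc' _ ⟨_, hp⟩ ?_
  have := isExposed_inter_of_mem_delaunayCells (hsub hc') hc
  rwa [Set.inter_comm, heq] at this

/-! ### Lower faces of the lifted hull -/

/-- The projection of the set of minimisers of a functional on the lifted hull. -/
theorem image_fst_minimisers_liftedHull (h : RSpace d →ᵃ[ℝ] ℝ) {a : ℝ} (ha : 0 < a)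
    (hh : ∀ x ∈ X, h x ≤ Q x) :
    Prod.fst '' {p : RSpace d × ℝ | p ∈ liftedHull Q X ∧ a * p.2 = a * h p.1}
      = convexHull ℝ (contactSet Q X h : Set (RSpace d)) := by
  classical
  set g : RSpace d × ℝ →ᵃ[ℝ] ℝ :=
    h.comp AffineMap.fst - (LinearMap.snd ℝ (RSpace d) ℝ).toAffineMap with hg
  have hgapp : ∀ p, g p = h p.1 - p.2 := fun p => by simp [hg]
  have key := (X.image fun x => (x, Q x)).convexHull_inter_affine_eq g 0 (by
    intro q hq
    obtain ⟨x, hx, rfl⟩ := Finset.mem_image.1 hq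
    rw [hgapp]; linarith [hh x hx])
  have h1 : {p : RSpace d × ℝ | p ∈ liftedHull Q X ∧ a * p.2 = a * h p.1}
      = {p | p ∈ convexHull ℝ ((X.image fun x => (x, Q x) : Finset (RSpace d × ℝ)) :
          Set (RSpace d × ℝ)) ∧ g p = 0} := by
    ext p
    simp only [Set.mem_ofPred_eq, Finset.coe_image, liftedHull, hgapp]
    refine and_congr_right fun _ => ?_
    rw [mul_right_inj' ha.ne', sub_eq_zero, eq_comm]
  rw [h1, key]
  have h2 := (LinearMap.fst ℝ (RSpace d) ℝ).image_convexHull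
    {x | x ∈ (X.image fun x => (x, Q x)) ∧ g x = 0}
  rw [LinearMap.coe_fst] at h2
  rw [h2]
  congr 1
  ext x
  constructor
  · rintro ⟨q, ⟨hq, hq0⟩, rfl⟩
    obtain ⟨y, hy, rfl⟩ := Finset.mem_image.1 hq
    rw [hgapp] at hq0
    exact mem_contactSet.2 ⟨hy, (sub_eq_zero.1 hq0).symm⟩
  · intro hx
    obtain ⟨hxX, hxQ⟩ := mem_contactSet.1 hx
    refine ⟨(x, Q x), ⟨Finset.mem_image_of_mem _ hxX, ?_⟩, rfl⟩
    rw [hgapp]; exact sub_eq_zero.2 hxQ.symm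

theorem le_of_mem_liftedHull {h : RSpace d →ᵃ[ℝ] ℝ} (hh : ∀ x ∈ X, h x ≤ Q x)
    {p : RSpace d × ℝ} (hp : p ∈ liftedHull Q X) : h p.1 ≤ p.2 := by
  have := le_of_mem_convexHull_of_le _
    (h.comp AffineMap.fst - (LinearMap.snd ℝ (RSpace d) ℝ).toAffineMap) 0 (by
      rintro q ⟨x, hx, rfl⟩
      simpa using hh x hx) hp
  simpa using this

theorem projectedLowerFaces_eq_delaunayCells (hne : X.Nonempty) :
    projectedLowerFaces Q X = delaunayCells Q X := by
  have hlift : ∀ x ∈ X, (x, Q x) ∈ liftedHull Q X := fun x hx =>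
    subset_convexHull ℝ _ ⟨x, hx, rfl⟩
  ext c
  constructor
  · rintro ⟨F, ⟨ψ, a, ha, rfl⟩, rfl⟩
    obtain ⟨y, hy, hymin⟩ := X.exists_min_image (fun x => ψ x + a * Q x) hne
    -- The supporting hyperplane `ψ x + a * t = ψ y + a * Q y`, solved for `t`.
    set h : RSpace d →ᵃ[ℝ] ℝ :=
      AffineMap.const ℝ _ (a⁻¹ * (ψ y + a * Q y)) - a⁻¹ • ψ.toAffineMap with hdef
    have happ : ∀ x, a * h x = (ψ y + a * Q y) - ψ x := fun x => by
      simp [hdef]; field_simp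
    have hh : ∀ x ∈ X, h x ≤ Q x := fun x hx => by
      have h1 := hymin x hx
      have h2 := happ x
      exact le_of_mul_le_mul_left (by linarith) ha
    refine ⟨h, hh, ⟨y, mem_contactSet.2 ⟨hy, ?_⟩⟩, ?_⟩
    · have := happ y
      exact mul_left_cancel₀ ha.ne' (by linarith)
    · rw [← image_fst_minimisers_liftedHull h ha hh]
      congr 1
      ext p
      refine and_congr_right fun hp => ⟨fun hmin => ?_, fun heq q hq => ?_⟩
      · have h1 := hmin _ (hlift y hy)
        have h2 := mul_le_mul_of_nonneg_left (le_of_mem_liftedHull hh hp) ha.le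
        rw [happ] at h2 ⊢
        linarith
      · have h2 := mul_le_mul_of_nonneg_left (le_of_mem_liftedHull hh hq) ha.le
        rw [happ] at h2 heq
        linarith
  · rintro ⟨h, hh, ⟨y, hy⟩, rfl⟩
    obtain ⟨hyX, hyQ⟩ := mem_contactSet.1 hy
    refine ⟨_, ⟨-h.linear, 1, one_pos, rfl⟩, ?_⟩
    rw [← image_fst_minimisers_liftedHull h one_pos hh]
    have hlin : ∀ x, h x = h.linear x + h 0 := fun x => congrFun h.decomp x
    congr 1
    ext p
    refine and_congr_right fun hp => ⟨fun heq q hq => ?_, fun hmin => ?_⟩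
    · have := le_of_mem_liftedHull hh hq
      simp only [LinearMap.neg_apply]
      linarith [hlin p.1, hlin q.1]
    · have h1 := hmin _ (hlift y hyX)
      have h2 := le_of_mem_liftedHull hh hp
      simp only [LinearMap.neg_apply] at h1
      linarith [hlin p.1, hlin y]

end Generic

theorem mainTheorem1 (d : ℕ) (hd : 1 ≤ d) (Q : QuadraticForm ℝ (RSpace d))
    (X : Finset (RSpace d)) (hcard : d + 1 ≤ X.card)
    (hspace : SpacelikePosition Q X) (hgen : GenericPosition Q X) :
    (∃! K : Set (Set (RSpace d)), IsQDelaunay Q X K) ∧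
      IsQDelaunay Q X (projectedLowerFaces Q X) := by
  -- Since `d ≥ 1`, there are two points, whose difference has positive `Q`.
  have hcard' : 1 < X.card := by omega
  rw [projectedLowerFaces_eq_delaunayCells (Finset.card_pos.1 (by omega))]
  have hK := isQDelaunay_delaunayCells hspace hgen hcard hcard'
  exact ⟨⟨_, hK, fun K hK' => hK'.eq_delaunayCells hspace hgen hcard hcard'⟩, hK⟩
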